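/- Write $z^*$ for the complex conjugate of $z$, $\mathbb C^{(\pm)}=\{\lambda:\pm\operatorname{Im}\lambda>0\}$, $\sigma_2=\begin{pmatrix}0&-i\\ i&0\end{pmatrix}$, $\sigma_3=\mathrm{diag}(1,-1)$. Boundary data. Let $N,M\ge 0$ be integers, $\epsilon\in\{1,-1\}$, $\beta_1,\dots,\beta_N\in\mathbb C$ with $\operatorname{Re}\beta_j\ne0$ and $\operatorname{Im}\beta_j\neq 0$, $\alpha_1,\dots,\alpha_M\in\mathbb R\setminus\{0\}$ (repetitions allowed), and $$f(\lambda)=\prod_{j=1}^N(\lambda-\beta_j)(\lambda+\beta_j^*)\prod_{\ell=1}^M(\lambda-i\alpha_\ell),\qquad g(\lambda)=f(\lambda^*)^*,\qquad \kappa(\lambda)=\epsilon\,\frac{f(\lambda)}{g(\lambda)}.$$ Let $\mathfrak D$ be the set of zeros of $f$ (the zeros of $\kappa$). Let $K_-(\lambda)$ be a reflection matrix (at a fixed time) with determinant $\kappa$: $K_-=\mathcal L/g$ with $\mathcal L$ a $2\times2$ matrix of polynomials of degree at most $2N+M$, and, away from poles, $\det K_-(\lambda)=\kappa(\lambda)$,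 $K_-(\lambda)^{-1}=K_-(-\lambda)$, $\kappa(-\lambda)K_-(\lambda)=\sigma_2\,K_-(\lambda^*)^*\,\sigma_2$ (entrywise conjugation), and $\lim_{\lambda\to\infty}K_-(\lambda)=\mathrm{diag}(1,\epsilon)$. Put $K_+(\lambda)=\mathrm{diag}(1,\kappa(\lambda))$. Jost solutions. Let $q\in\mathcal S(\mathbb R^+)$, that is, $q:[0,\infty)\to\mathbb C$ is smooth and $x^m q^{(n)}(x)$ is bounded on $[0,\infty)$ for all $m,n\ge0$. Let $U(x;\lambda)=-i\lambda\sigma_3+\begin{pmatrix}0&q(x)\\-q(x)^*&0\end{pmatrix}$, let $T(x,y;\lambda)$ be the path-ordered exponential of $\int_y^xU(\xi;\lambda)\,d\xi$ (so $\partial_xT=UT$ and $T(y,y;\lambda)=I$), and for $x\ge 0$, $\lambda\in\mathbb R$ put $$F(x;\lambda)=\lim_{L\to\infty}T(x,L;\lambda)e^{-i\lambda L\sigma_3},\qquad G(x;\lambda)=\lim_{L\to\infty}T(x,0;\lambda)K_-(-\lambda)T(L,0;-\lambda)^{-1}e^{i\lambda L\sigma_3}K_+(\lambda),$$ $$X(x;\lambda)=F(x;\lambda)e^{i\lambda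 x\sigma_3},\qquad Y(x;\lambda)=G(x;\lambda)e^{i\lambda x\sigma_3}.$$ Claim. Assume $\mathfrak D\subset\mathbb C^{(-)}$. Then, for every $x\ge0$, the limits defining $F(x;\lambda)$ and $G(x;\lambda)$ exist for all $\lambda\in\mathbb R$, and there are $\mathbb C^2$-valued functions $X^{(\pm)}(x;\cdot)$, $Y^{(\pm)}(x;\cdot)$ such that, for $\lambda\in\mathbb R$, $X$ and $Y$ have the columns $$X=(X^{(-)},X^{(+)}),\qquad Y=(Y^{(+)},Y^{(-)}),$$ where, as functions of $\lambda$, $X^{(+)}$ and $Y^{(+)}$ are analytic in $\mathbb C^{(+)}$ and continuous and bounded on $\mathbb C^{(+)}\cup\mathbb R$, and $X^{(-)}$ and $Y^{(-)}$ are analytic in $\mathbb C^{(-)}$ and continuous and bounded on $\mathbb C^{(-)}\cup\mathbb R$. -/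

import Mathlib

open Filter Topology Polynomial

open scoped ContDiff

noncomputable section

namespace HalfLineNLS

/-- The space of complex `2 × 2` matrices. -/
abbrev Mat2 : Type := Matrix (Fin 2) (Fin 2) ℂ

/-- The Pauli matrix `σ₂`. -/
def sigma2 : Mat2 := !![0, -Complex.I; Complex.I, 0]

/-- The Pauli matrix `σ₃`. -/
def sigma3 : Mat2 := !![1, 0; 0, -1]

/-- The matrix exponential `exp (w σ₃) = diag (exp w, exp (-w))`. -/
def expSigma3 (w : ℂ) : Mat2 := !![Complex.exp w, 0; 0, Complex.exp (-w)]

/-- The class of Schwartz-type functions on the half-line: `q` is smooth on `[0, ∞)` (with one-sided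
derivatives at `0`) and all its derivatives decay faster than every power of `x`. Values of `q` at
negative arguments are irrelevant. -/
def IsSchwartzHalfLine (q : ℝ → ℂ) : Prop :=
  ContDiffOn ℝ ∞ q (Set.Ici 0) ∧
    ∀ m n : ℕ, ∃ C : ℝ, ∀ x : ℝ, 0 ≤ x →
      x ^ m * ‖iteratedDerivWithin n q (Set.Ici 0) x‖ ≤ C

/-! ### The space part of the Lax pair and the transition matrix -/

/-- The potential matrix `Q`. -/
def potQ (q : ℝ → ℂ) (x : ℝ) : Mat2 := !![0, q x; -(starRingEnd ℂ) (q x), 0]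

/-- The space part `U = -i z σ₃ + Q` of the Lax pair, at spectral parameter `z`. -/
def laxU (q : ℝ → ℂ) (z : ℂ) (x : ℝ) : Mat2 := (-Complex.I * z) • sigma3 + potQ q x

/-- The terms of the path-ordered exponential of `U` with base point `y`: the `n`-th one is the
iterated integral `∫_y^x U(ξ₁) ∫_y^ξ₁ U(ξ₂) ⋯ dξₙ ⋯ dξ₁`. -/
def orderedTerm (U : ℝ → Mat2) (y : ℝ) : ℕ → ℝ → Mat2
  | 0, _ => 1
  | n + 1, x => Matrix.of fun i j => ∫ ξ in y..x, (U ξ * orderedTerm U y n ξ) i j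

/-- The path-ordered exponential of `U` from `y` to `x`. -/
def orderedExp (U : ℝ → Mat2) (x y : ℝ) : Mat2 := ∑' n : ℕ, orderedTerm U y n x

/-- The transition matrix `T(x, y; z)`. -/
def transition (q : ℝ → ℂ) (x y : ℝ) (z : ℂ) : Mat2 := orderedExp (laxU q z) x y

/-! ### The boundary: the function `κ` and the reflection matrices -/

/-- The parameters of a function `κ`: `N` complex numbers `β_j` off the real and imaginary axes,
`M` nonzero real numbers `α_l`, and a sign `ε`. No restriction on multiplicities. -/
structure KappaData where
  N : ℕ
  M : ℕ
  β : Fin N → ℂ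
  α : Fin M → ℝ
  ε : ℂ
  β_re : ∀ j, (β j).re ≠ 0
  β_im : ∀ j, (β j).im ≠ 0
  α_ne : ∀ l, α l ≠ 0
  ε_sign : ε = 1 ∨ ε = -1

/-- The numerator `f(z) = ∏ (z - β_j)(z + β_j^*) ∏ (z - i α_l)`. -/
def KappaData.f (d : KappaData) : ℂ[X] :=
  (∏ j, ((X - C (d.β j)) * (X + C ((starRingEnd ℂ) (d.β j))))) *
    ∏ l, (X - C (Complex.I * (d.α l : ℂ)))

/-- The denominator `g(z) = (f(z^*))^*`: the coefficients of `f` are conjugated. -/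
def KappaData.g (d : KappaData) : ℂ[X] := d.f.map (starRingEnd ℂ)

/-- `κ(z) = ε f(z) / g(z)`. -/
def KappaData.kappa (d : KappaData) (z : ℂ) : ℂ := d.ε * (d.f.eval z / d.g.eval z)

/-- The set of zeros of `κ`, that is, of its numerator `f` (poles of `κ` are not in it unless
they are zeros of `f`). -/
def KappaData.zeros (d : KappaData) : Set ℂ := {z | d.f.eval z = 0}

/-- `K` is, at a fixed time, a reflection matrix with determinant `κ`: a matrix `L / g` with
polynomial entries of degree at most `2 N + M` in the numerator `L`, normalized by
`K(z)⁻¹ = K(-z)`, `κ(-z) K(z) = σ₂ K(z^*)^* σ₂` and `K(∞) = diag (1, ε)`. The identities are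
required away from the poles. -/
structure IsReflectionMatrix (d : KappaData) (K : ℂ → Mat2) : Prop where
  rational : ∃ L : Matrix (Fin 2) (Fin 2) ℂ[X],
    (∀ i j, (L i j).natDegree ≤ 2 * d.N + d.M) ∧
      ∀ z, d.g.eval z ≠ 0 → K z = (d.g.eval z)⁻¹ • L.map (Polynomial.eval z)
  det_eq : ∀ z, d.g.eval z ≠ 0 → (K z).det = d.kappa z
  inv_eq : ∀ z, d.g.eval z ≠ 0 → d.g.eval (-z) ≠ 0 → (K z)⁻¹ = K (-z)
  conj_eq : ∀ z, d.g.eval z ≠ 0 → d.g.eval (-z) ≠ 0 →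
    d.kappa (-z) • K z =
      sigma2 * (K ((starRingEnd ℂ) z)).map (starRingEnd ℂ) * sigma2
  limit : Tendsto K (cocompact ℂ) (𝓝 !![1, 0; 0, d.ε])

/-- The constant reflection matrix `K₊ = diag (1, κ)` at infinity. -/
def KappaData.Kplus (d : KappaData) (z : ℂ) : Mat2 := !![1, 0; 0, d.kappa z]

/-! ### The half-line Jost solutions -/

/-- `T(x, L; z) exp (-i z L σ₃)`, whose limit as `L → ∞` is `F`. -/
def approxF (q : ℝ → ℂ) (x : ℝ) (z : ℂ) (L : ℝ) : Mat2 :=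
  transition q x L z * expSigma3 (-Complex.I * z * (L : ℂ))

/-- `T(x, 0; z) K₋(-z) T(L, 0; -z)⁻¹ exp (i z L σ₃) K₊(z)`, whose limit as `L → ∞` is `G`. -/
def approxG (q : ℝ → ℂ) (d : KappaData) (K : ℂ → Mat2) (x : ℝ) (z : ℂ) (L : ℝ) : Mat2 :=
  transition q x 0 z * K (-z) * (transition q L 0 (-z))⁻¹ *
    expSigma3 (Complex.I * z * (L : ℂ)) * d.Kplus z

/-- The first Jost solution `F(x; z)`. -/
def jostF (q : ℝ → ℂ) (x : ℝ) (z : ℂ) : Mat2 := limUnder atTop (approxF q x z)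

/-- The second Jost solution `G(x; z)`. -/
def jostG (q : ℝ → ℂ) (d : KappaData) (K : ℂ → Mat2) (x : ℝ) (z : ℂ) : Mat2 :=
  limUnder atTop (approxG q d K x z)

/-- The modified Jost solution `X(x; z) = F(x; z) exp (i z x σ₃)`. -/
def modX (q : ℝ → ℂ) (x : ℝ) (z : ℂ) : Mat2 :=
  jostF q x z * expSigma3 (Complex.I * z * (x : ℂ))

/-- The modified Jost solution `Y(x; z) = G(x; z) exp (i z x σ₃)`. -/
def modY (q : ℝ → ℂ) (d : KappaData) (K : ℂ → Mat2) (x : ℝ) (z : ℂ) : Mat2 :=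
  jostG q d K x z * expSigma3 (Complex.I * z * (x : ℂ))

/-- The matrix with columns `u` and `v`. -/
def ofCols (u v : Fin 2 → ℂ) : Mat2 := !![u 0, v 0; u 1, v 1]

/-- The open upper half-plane. -/
def upperPlane : Set ℂ := {z | 0 < z.im}

/-- The open lower half-plane. -/
def lowerPlane : Set ℂ := {z | z.im < 0}

/-- `v` is analytic on the open set `S`, and bounded and continuous on the closure of `S` (so that
its values on the boundary of `S` are the boundary values of the analytic function). -/
def IsBoundedAnalytic (S : Set ℂ) (v : ℂ → Fin 2 → ℂ) : Prop :=
  AnalyticOnNhd ℂ v S ∧ ContinuousOn v (closure S) ∧ ∃ B : ℝ, ∀ z ∈ closure S, ‖v z‖ ≤ B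

end HalfLineNLS

end

noncomputable section

namespace HalfLineNLS

/-! ### The path-ordered exponential solves the linear equation -/

section OrderedExp

variable {U : ℝ → Mat2} {y : ℝ}

/-! After multiplication by a scalar exponential, a column of the transition matrix satisfies `u' =
-2izu + pv`, `v' = -p^* u`. The potential is skew-Hermitian, so `|u|² + |v|²` has derivative `4 Im z
|u|²`. Hence for `Im z ≥ 0` the solution with data `(0, 1)` at `L` is bounded by `1` to the left of
`L`, and moving `L` to a larger `L'` changes it by at most `√(2C/L)`, where `C` bounds `x²|p|`
(`gaugedSolution_bounds`). These estimates are uniform on the closed half-plane and the approximants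
are entire in `z` (`differentiable_transition`), so the limit is analytic inside, continuous and
bounded up to the real axis (`exists_isBoundedAnalytic_limit`). Exchanging the two components turns
`z` into `-z` and settles the other half-plane. This gives `X`.

For real `z`, `T(L,0;-z)⁻¹ = T(0,L;-z)`, so `G(x;z) = T(x,0;z) K₋(-z) X(0;-z) K₊(z)`. The sign
change swaps the half-planes: the first column continues upwards, the second downwards, and the same
energy identity bounds `exp(±izx) T(x,0;z)` there. Since the zeros of `f` lie below the real axis,
those of `g` lie above it, and `K₋(-z) = L(-z)/g(-z)` is regular for `Im z ≥ 0`. In the second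
column `K₊` supplies `κ(z)`; as `f(z) = (-1)^M g(-z)`, the poles cancel and `ε(-1)^M L(-z)/g(z)`
remains, regular for `Im z ≤ 0`. Boundedness follows from `deg L ≤ deg g`. -/

lemma continuous_orderedTerm (hU : ∀ i j, Continuous fun x => U x i j) (n : ℕ) :
    ∀ i j, Continuous fun x => orderedTerm U y n x i j := by
  induction n with
  | zero => intro i j; exact continuous_const
  | succ n ih =>
    intro i j
    have hc : Continuous fun ξ => (U ξ * orderedTerm U y n ξ) i j := by
      simp only [Matrix.mul_apply]
      exact continuous_finsetSum _ fun l _ => (hU i l).mul (ih l j)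
    exact intervalIntegral.continuous_primitive (fun a b => hc.intervalIntegrable a b) y

lemma continuous_mul_orderedTerm (hU : ∀ i j, Continuous fun x => U x i j) (n : ℕ) (i j : Fin 2) :
    Continuous fun ξ => (U ξ * orderedTerm U y n ξ) i j := by
  simp only [Matrix.mul_apply]
  exact continuous_finsetSum _ fun l _ => (hU i l).mul (continuous_orderedTerm hU n l j)

lemma hasDerivAt_orderedTerm_succ (hU : ∀ i j, Continuous fun x => U x i j) (n : ℕ)
    (i j : Fin 2) (x : ℝ) :
    HasDerivAt (fun x => orderedTerm U y (n + 1) x i j) ((U x * orderedTerm U y n x) i j) x :=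
  (continuous_mul_orderedTerm hU n i j).integral_hasStrictDerivAt y x |>.hasDerivAt

lemma norm_mul_apply_le {A B : Mat2} {a b : ℝ} (hA : ∀ i j, ‖A i j‖ ≤ a)
    (hB : ∀ i j, ‖B i j‖ ≤ b) (i j : Fin 2) : ‖(A * B) i j‖ ≤ 2 * a * b := by
  have ha : 0 ≤ a := (norm_nonneg _).trans (hA 0 0)
  rw [Matrix.mul_apply, Fin.sum_univ_two]
  calc _ ≤ ‖A i 0‖ * ‖B 0 j‖ + ‖A i 1‖ * ‖B 1 j‖ := by
        simpa only [norm_mul] using norm_add_le (A i 0 * B 0 j) (A i 1 * B 1 j)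
    _ ≤ a * b + a * b := by
        gcongr
        exacts [hA _ _, hB _ _, hA _ _, hB _ _]
    _ = 2 * a * b := by ring

lemma norm_orderedTerm_le {M : ℝ} (hM : ∀ x i j, ‖U x i j‖ ≤ M) (n : ℕ) :
    ∀ (x : ℝ) (i j : Fin 2), ‖orderedTerm U y n x i j‖ ≤ (2 * M * |x - y|) ^ n / n.factorial := by
  have hM0 : 0 ≤ M := (norm_nonneg _).trans (hM 0 0 0)
  induction n with
  | zero =>
    intro x i j
    fin_cases i <;> fin_cases j <;> simp [orderedTerm]
  | succ n ih =>
    intro x i j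
    have hg : Continuous fun ξ : ℝ => 2 * M * ((2 * M * |ξ - y|) ^ n / n.factorial) := by fun_prop
    have h1 : ‖orderedTerm U y (n + 1) x i j‖ ≤
        |∫ ξ in y..x, 2 * M * ((2 * M * |ξ - y|) ^ n / n.factorial)| :=
      intervalIntegral.norm_integral_le_abs_of_norm_le
        (Eventually.of_forall fun ξ => norm_mul_apply_le (hM ξ) (ih ξ) i j)
        (hg.intervalIntegrable _ _)
    have h2 : ∀ ξ : ℝ, 2 * M * ((2 * M * |ξ - y|) ^ n / n.factorial) =
        (2 * M) ^ (n + 1) / n.factorial * |ξ - y| ^ n := by intro ξ; ring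
    refine h1.trans (le_of_eq ?_)
    simp_rw [h2]
    rw [intervalIntegral.integral_const_mul, abs_mul, intervalIntegral.abs_intervalIntegral_eq,
      integral_pow_abs_sub_uIoc, abs_of_nonneg (by positivity), abs_of_nonneg (by positivity),
      Nat.factorial_succ]
    push_cast
    field_simp
    rw [mul_pow (2 * M)]

lemma summable_orderedTerm_apply {M : ℝ} (hM : ∀ x i j, ‖U x i j‖ ≤ M) (x : ℝ) (i j : Fin 2) :
    Summable fun n => orderedTerm U y n x i j :=
  .of_norm_bounded (Real.summable_pow_div_factorial (2 * M * |x - y|))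
    fun n => norm_orderedTerm_le hM n x i j

lemma orderedExp_apply {M : ℝ} (hM : ∀ x i j, ‖U x i j‖ ≤ M) (x : ℝ) (i j : Fin 2) :
    orderedExp U x y i j = ∑' n, orderedTerm U y n x i j := by
  have h : Summable fun n => orderedTerm U y n x :=
    Pi.summable.2 fun i => Pi.summable.2 fun j => summable_orderedTerm_apply hM x i j
  have h1 := tsum_apply (x := i) h
  have h2 := tsum_apply (x := j) (Pi.summable.1 h i)
  exact (congrFun h1 j).trans h2

lemma orderedExp_self {M : ℝ} (hM : ∀ x i j, ‖U x i j‖ ≤ M) : orderedExp U y y = 1 := by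
  ext i j
  rw [orderedExp_apply hM, tsum_eq_single 0]
  · rfl
  · intro n hn
    obtain ⟨m, rfl⟩ := Nat.exists_eq_succ_of_ne_zero hn
    simp [orderedTerm]

lemma orderedExp_apply_eq_add {M : ℝ} (hM : ∀ x i j, ‖U x i j‖ ≤ M) (x : ℝ) (i j : Fin 2) :
    orderedExp U x y i j = (1 : Mat2) i j + ∑' n, orderedTerm U y (n + 1) x i j := by
  rw [orderedExp_apply hM, (summable_orderedTerm_apply hM x i j).tsum_eq_zero_add]
  rfl

lemma mul_orderedExp_apply {M : ℝ} (hM : ∀ x i j, ‖U x i j‖ ≤ M) (A : Mat2) (x : ℝ) (i j : Fin 2) :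
    (A * orderedExp U x y) i j = ∑' n, (A * orderedTerm U y n x) i j := by
  simp only [Matrix.mul_apply, orderedExp_apply hM]
  rw [Summable.tsum_finsetSum fun l _ => (summable_orderedTerm_apply hM x l j).mul_left _]
  simp only [tsum_mul_left]

lemma hasDerivAt_orderedExp (hU : ∀ i j, Continuous fun x => U x i j) {M : ℝ}
    (hM : ∀ x i j, ‖U x i j‖ ≤ M) (x : ℝ) (i j : Fin 2) :
    HasDerivAt (fun x => orderedExp U x y i j) ((U x * orderedExp U x y) i j) x := by
  have hM0 : 0 ≤ M := (norm_nonneg _).trans (hM 0 0 0)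
  -- The factorial bound is uniform only on bounded sets, so the series is differentiated term by
  -- term on a ball around `y` that contains `x`.
  obtain ⟨R, hR⟩ : ∃ R, |x - y| < R := exists_gt _
  have hx : x ∈ Metric.ball y R := by rwa [Metric.mem_ball, Real.dist_eq]
  have hbound : ∀ (n : ℕ) (ξ : ℝ), ξ ∈ Metric.ball y R →
      ‖(U ξ * orderedTerm U y n ξ) i j‖ ≤ 2 * M * ((2 * M * R) ^ n / n.factorial) := by
    intro n ξ hξ
    rw [Metric.mem_ball, Real.dist_eq] at hξ
    refine norm_mul_apply_le (hM ξ) (fun i j => (norm_orderedTerm_le hM n ξ i j).trans ?_) i j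
    have := hξ.le
    gcongr
  have h := hasDerivAt_tsum_of_isPreconnected
    (g := fun n x => orderedTerm U y (n + 1) x i j)
    (g' := fun n x => (U x * orderedTerm U y n x) i j)
    ((Real.summable_pow_div_factorial _).mul_left _) Metric.isOpen_ball
    (convex_ball y R).isPreconnected (fun n ξ _ => hasDerivAt_orderedTerm_succ hU n i j ξ)
    hbound hx ((summable_nat_add_iff 1).2 (summable_orderedTerm_apply hM x i j)) hx
  rw [mul_orderedExp_apply hM]
  exact (h.const_add ((1 : Mat2) i j)).congr_of_eventuallyEq
    (Eventually.of_forall fun x => orderedExp_apply_eq_add hM x i j)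

lemma orderedTerm_congr {V : ℝ → Mat2} {s : Set ℝ} (hs : s.OrdConnected)
    (hUV : ∀ x ∈ s, U x = V x) (hy : y ∈ s) (n : ℕ) :
    ∀ x ∈ s, orderedTerm U y n x = orderedTerm V y n x := by
  induction n with
  | zero => intro x _; rfl
  | succ n ih =>
    intro x hx
    ext i j
    refine intervalIntegral.integral_congr fun ξ hξ => ?_
    have hξs := hs.uIcc_subset hy hx hξ
    simp only [hUV ξ hξs, ih ξ hξs]

lemma orderedExp_congr {V : ℝ → Mat2} {s : Set ℝ} (hs : s.OrdConnected)
    (hUV : ∀ x ∈ s, U x = V x) {x : ℝ} (hx : x ∈ s) (hy : y ∈ s) :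
    orderedExp U x y = orderedExp V x y := by
  simp only [orderedExp, orderedTerm_congr hs hUV hy _ x hx]

end OrderedExp

/-! ### The transition matrix -/

section Transition

variable {p : ℝ → ℂ} {B : ℝ}

lemma continuous_laxU (hp : Continuous p) (z : ℂ) (i j : Fin 2) :
    Continuous fun x => laxU p z x i j := by
  have hp' : Continuous fun x => (starRingEnd ℂ) (p x) := Complex.continuous_conj.comp hp
  fin_cases i <;> fin_cases j <;> simp [laxU, potQ, sigma3] <;> fun_prop

lemma norm_laxU_le (hB : ∀ x, ‖p x‖ ≤ B) (z : ℂ) (x : ℝ) (i j : Fin 2) :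
    ‖laxU p z x i j‖ ≤ ‖z‖ + B := by
  have h0 := norm_nonneg z
  have h1 := norm_nonneg (p x)
  have h2 := hB x
  fin_cases i <;> fin_cases j <;> simp [laxU, potQ, sigma3] <;> linarith

lemma transition_self (hB : ∀ x, ‖p x‖ ≤ B) (y : ℝ) (z : ℂ) :
    transition p y y z = 1 :=
  orderedExp_self (norm_laxU_le hB z)

lemma hasDerivAt_transition_zero (hp : Continuous p) (hB : ∀ x, ‖p x‖ ≤ B) (y x : ℝ) (z : ℂ)
    (j : Fin 2) : HasDerivAt (fun x => transition p x y z 0 j)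
      (-Complex.I * z * transition p x y z 0 j + p x * transition p x y z 1 j) x := by
  refine (hasDerivAt_orderedExp (continuous_laxU hp z) (norm_laxU_le hB z) x 0 j).congr_deriv ?_
  simp [Matrix.mul_apply, Fin.sum_univ_two, laxU, potQ, sigma3, transition]

lemma hasDerivAt_transition_one (hp : Continuous p) (hB : ∀ x, ‖p x‖ ≤ B) (y x : ℝ) (z : ℂ)
    (j : Fin 2) : HasDerivAt (fun x => transition p x y z 1 j)
      (-(starRingEnd ℂ) (p x) * transition p x y z 0 j +
        Complex.I * z * transition p x y z 1 j) x := by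
  refine (hasDerivAt_orderedExp (continuous_laxU hp z) (norm_laxU_le hB z) x 1 j).congr_deriv ?_
  simp [Matrix.mul_apply, Fin.sum_univ_two, laxU, potQ, sigma3, transition]

/-- Since `U` is affine in `z`, each iterated integral is a polynomial in `z`; its holomorphy then
needs no differentiation under the integral sign. -/
lemma exists_orderedTerm_laxU_eq_sum (hp : Continuous p) (y : ℝ) (n : ℕ) :
    ∃ c : ℕ → ℝ → Mat2, (∀ k i j, Continuous fun x => c k x i j) ∧
      ∀ z x i j, orderedTerm (laxU p z) y n x i j =
        ∑ k ∈ Finset.range (n + 1), z ^ k * c k x i j := by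
  induction n with
  | zero =>
    refine ⟨fun _ _ => 1, fun _ _ _ => continuous_const, fun z x i j => ?_⟩
    simp [orderedTerm]
  | succ n ih =>
    obtain ⟨c, hc, hsum⟩ := ih
    -- `a` comes from the `z σ₃` part of `U`, which raises the power of `z` by one, and `b` from the
    -- potential, which keeps it. The zeros fill the missing power at either end.
    let a : ℕ → ℝ → Mat2 := fun k ξ => if k = 0 then 0 else (-Complex.I) • sigma3 * c (k - 1) ξ
    let b : ℕ → ℝ → Mat2 := fun k ξ => if k = n + 1 then 0 else potQ p ξ * c k ξ
    have ha : ∀ k i j, Continuous fun ξ => a k ξ i j := by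
      intro k i j
      by_cases hk : k = 0
      · simp only [a, hk, if_true, Matrix.zero_apply]; exact continuous_const
      · simp only [a, hk, if_false, Matrix.mul_apply]
        exact continuous_finsetSum _ fun l _ => continuous_const.mul (hc _ _ _)
    have hQ : ∀ i j, Continuous fun ξ => potQ p ξ i j := by
      simpa [laxU] using continuous_laxU hp 0
    have hb : ∀ k i j, Continuous fun ξ => b k ξ i j := by
      intro k i j
      by_cases hk : k = n + 1
      · simp only [b, hk, if_true, Matrix.zero_apply]; exact continuous_const
      · simp only [b, hk, if_false, Matrix.mul_apply]
        exact continuous_finsetSum _ fun l _ => (hQ _ _).mul (hc _ _ _)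
    refine ⟨fun k x => Matrix.of fun i j => ∫ ξ in y..x, (a k ξ i j + b k ξ i j),
      fun k i j => ?_, fun z x i j => ?_⟩
    · exact intervalIntegral.continuous_primitive
        (fun s t => ((ha k i j).add (hb k i j)).intervalIntegrable s t) y
    · have hint : ∀ k, IntervalIntegrable (fun ξ => z ^ k * (a k ξ i j + b k ξ i j))
          MeasureTheory.volume y x := fun k =>
        (continuous_const.mul ((ha k i j).add (hb k i j))).intervalIntegrable y x
      simp only [Matrix.of_apply, ← intervalIntegral.integral_const_mul]
      refine Eq.trans ?_ (intervalIntegral.integral_finsetSum fun k _ => hint k)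
      refine intervalIntegral.integral_congr fun ξ _ => ?_
      simp only [mul_add, Finset.sum_add_distrib]
      rw [Finset.sum_range_succ', Finset.sum_range_succ (fun k => z ^ k * b k ξ i j)]
      have hb' : ∑ k ∈ Finset.range (n + 1), z ^ k * b k ξ i j =
          ∑ k ∈ Finset.range (n + 1), z ^ k * (potQ p ξ * c k ξ) i j :=
        Finset.sum_congr rfl fun k hk => by
          have : k ≠ n + 1 := (Finset.mem_range.1 hk).ne
          simp [b, this]
      rw [hb']
      simp only [Matrix.mul_apply, hsum, laxU, Fin.sum_univ_two, a, b, if_true, Nat.succ_ne_zero,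
        if_false, Nat.add_sub_cancel, Matrix.add_apply, Matrix.smul_apply, smul_eq_mul,
        Matrix.zero_apply, mul_zero, add_zero, Finset.mul_sum, ← Finset.sum_add_distrib]
      exact Finset.sum_congr rfl fun k _ => by ring

lemma differentiable_transition (hp : Continuous p) (hB : ∀ x, ‖p x‖ ≤ B) (x y : ℝ)
    (i j : Fin 2) : Differentiable ℂ fun z => transition p x y z i j := by
  have hB0 : 0 ≤ B := (norm_nonneg _).trans (hB 0)
  intro z₀
  have hfun : (fun z => transition p x y z i j) =
      fun z => ∑' n, orderedTerm (laxU p z) y n x i j := by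
    ext z
    exact orderedExp_apply (norm_laxU_le hB z) x i j
  rw [hfun]
  refine (Complex.differentiableOn_tsum_of_summable_norm (U := Metric.ball 0 (‖z₀‖ + 1))
    (Real.summable_pow_div_factorial (2 * (‖z₀‖ + 1 + B) * |x - y|)) (fun n => ?_)
    Metric.isOpen_ball fun n z hz => ?_).differentiableAt
    (Metric.isOpen_ball.mem_nhds (by simp))
  · obtain ⟨c, -, hsum⟩ := exists_orderedTerm_laxU_eq_sum hp y n
    simp_rw [hsum]
    fun_prop
  · refine (norm_orderedTerm_le (norm_laxU_le hB z) n x i j).trans ?_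
    have : ‖z‖ ≤ ‖z₀‖ + 1 := by simpa using (Metric.mem_ball.1 hz).le
    gcongr

end Transition

/-! ### Energy estimates for the gauged equation -/

/-- `(u, v)` solves the Lax equation of potential `p` after the gauge transformation that makes the
diagonal part of the equation `diag (-2 i z, 0)`. -/
structure IsGaugedSolution (p : ℝ → ℂ) (z : ℂ) (u v : ℝ → ℂ) : Prop where
  fst : ∀ x, HasDerivAt u (-2 * Complex.I * z * u x + p x * v x) x
  snd : ∀ x, HasDerivAt v (-(starRingEnd ℂ) (p x) * u x) x

namespace IsGaugedSolution

variable {p : ℝ → ℂ} {z : ℂ} {u v u' v' : ℝ → ℂ}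

lemma sub (h : IsGaugedSolution p z u v) (h' : IsGaugedSolution p z u' v') :
    IsGaugedSolution p z (fun x => u x - u' x) (fun x => v x - v' x) where
  fst x := ((h.fst x).sub (h'.fst x)).congr_deriv (by ring)
  snd x := ((h.snd x).sub (h'.snd x)).congr_deriv (by ring)

/-- The skew-Hermitian coupling cancels except for its pairing with `c`. The value `c = 0` gives the
energy identity, `c = 1` the deviation from the data `(0, 1)`. -/
lemma hasDerivAt_energy_sub (h : IsGaugedSolution p z u v) (c : ℂ) (x : ℝ) :
    HasDerivAt (fun x => ‖u x‖ ^ 2 + ‖v x - c‖ ^ 2)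
      (4 * z.im * ‖u x‖ ^ 2 + 2 * ((starRingEnd ℂ) (c * p x) * u x).re) x := by
  refine ((h.fst x).norm_sq.add ((h.snd x).sub_const c).norm_sq).congr_deriv ?_
  simp only [Complex.inner, ← Complex.normSq_eq_norm_sq, Complex.normSq_apply]
  simp
  ring

lemma hasDerivAt_energy (h : IsGaugedSolution p z u v) (x : ℝ) :
    HasDerivAt (fun x => ‖u x‖ ^ 2 + ‖v x‖ ^ 2) (4 * z.im * ‖u x‖ ^ 2) x := by
  simpa using h.hasDerivAt_energy_sub 0 x

lemma energy_mono (h : IsGaugedSolution p z u v) (hz : 0 ≤ z.im) {x y : ℝ} (hxy : x ≤ y) :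
    ‖u x‖ ^ 2 + ‖v x‖ ^ 2 ≤ ‖u y‖ ^ 2 + ‖v y‖ ^ 2 :=
  monotone_of_hasDerivAt_nonneg (fun x => h.hasDerivAt_energy x) (fun x => by
    show 0 ≤ 4 * z.im * ‖u x‖ ^ 2
    positivity) hxy

lemma energy_anti (h : IsGaugedSolution p z u v) (hz : z.im ≤ 0) {x y : ℝ} (hxy : x ≤ y) :
    ‖u y‖ ^ 2 + ‖v y‖ ^ 2 ≤ ‖u x‖ ^ 2 + ‖v x‖ ^ 2 :=
  antitone_of_hasDerivAt_nonpos (fun x => h.hasDerivAt_energy x) (fun x => by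
    show 4 * z.im * ‖u x‖ ^ 2 ≤ 0
    have := sq_nonneg ‖u x‖
    nlinarith) hxy

/-- As `|u| ≤ 1` on `[L, L']`, the derivative of `|u|² + |v - 1|²` is at least `-2|p| ≥ -2C/x²`.
Subtracting `2C/x` therefore leaves a monotone function, which is compared at `L` and `L'`. -/
lemma energy_sub_one_le (h : IsGaugedSolution p z u v) (hz : 0 ≤ z.im) {C : ℝ}
    (hC : ∀ x, 0 ≤ x → x ^ 2 * ‖p x‖ ≤ C) {L L' : ℝ} (hL : 0 < L) (hLL' : L ≤ L')
    (hu : u L' = 0) (hv : v L' = 1) : ‖u L‖ ^ 2 + ‖v L - 1‖ ^ 2 ≤ 2 * C / L := by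
  have hC0 : 0 ≤ C := by simpa using hC 0 le_rfl
  have hder : ∀ x, 0 < x → HasDerivAt (fun x => ‖u x‖ ^ 2 + ‖v x - 1‖ ^ 2 - 2 * C * x⁻¹)
      (4 * z.im * ‖u x‖ ^ 2 + 2 * ((starRingEnd ℂ) (1 * p x) * u x).re -
        2 * C * -(x ^ 2)⁻¹) x := fun x hx =>
    (h.hasDerivAt_energy_sub 1 x).sub ((hasDerivAt_inv hx.ne').const_mul _)
  have hmono : MonotoneOn (fun x => ‖u x‖ ^ 2 + ‖v x - 1‖ ^ 2 - 2 * C * x⁻¹) (Set.Icc L L') := by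
    refine monotoneOn_of_hasDerivWithinAt_nonneg (convex_Icc _ _)
      (fun x hx => (hder x (hL.trans_le hx.1)).continuousAt.continuousWithinAt)
      (fun x hx => (hder x (hL.trans_le (interior_subset hx).1)).hasDerivWithinAt) fun x hx => ?_
    have hx' := interior_subset hx
    have hx0 : 0 < x := hL.trans_le hx'.1
    have hu1 : ‖u x‖ ≤ 1 := by
      have := h.energy_mono hz hx'.2
      rw [hu, hv] at this
      simp only [norm_zero, norm_one] at this
      nlinarith [norm_nonneg (u x), sq_nonneg ‖v x‖]
    have hre : -‖p x‖ ≤ ((starRingEnd ℂ) (1 * p x) * u x).re := by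
      refine le_trans (neg_le_neg ?_) (neg_le_of_abs_le (Complex.abs_re_le_norm _))
      rw [norm_mul, RCLike.norm_conj, one_mul]
      exact mul_le_of_le_one_right (norm_nonneg _) hu1
    have hp : ‖p x‖ ≤ C * (x ^ 2)⁻¹ := by
      rw [← div_eq_mul_inv, le_div_iff₀ (by positivity), mul_comm]
      exact hC x hx0.le
    have : 0 ≤ 4 * z.im * ‖u x‖ ^ 2 := by positivity
    linarith
  have := hmono ⟨le_rfl, hLL'⟩ ⟨hLL', le_rfl⟩ hLL'
  simp only [hu, hv, sub_self, norm_zero] at this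
  have h3 : 0 ≤ 2 * C * L'⁻¹ := by
    have := hL.trans_le hLL'
    positivity
  rw [div_eq_mul_inv]
  linarith

end IsGaugedSolution

lemma le_of_sq_add_sq_le {a b r : ℝ} (hr : 0 ≤ r) (h : a ^ 2 + b ^ 2 ≤ r ^ 2) : a ≤ r ∧ b ≤ r :=
  ⟨abs_le_of_sq_le_sq' (by nlinarith [sq_nonneg b]) hr |>.2,
    abs_le_of_sq_le_sq' (by nlinarith [sq_nonneg a]) hr |>.2⟩

/-- Bounds, uniform in the spectral parameter, for the gauged solutions with the data `(0, 1)` at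
`L`: they are bounded by `1`, and they form a Cauchy family as `L → ∞`. -/
lemma gaugedSolution_bounds {p : ℝ → ℂ} {z : ℂ} {u v : ℝ → ℝ → ℂ}
    (h : ∀ L, IsGaugedSolution p z (u L) (v L)) (hu : ∀ L, u L L = 0) (hv : ∀ L, v L L = 1)
    (hz : 0 ≤ z.im) {C : ℝ} (hC : ∀ x, 0 ≤ x → x ^ 2 * ‖p x‖ ≤ C) {x L : ℝ} (hL : 0 < L)
    (hxL : x ≤ L) :
    (‖u L x‖ ≤ 1 ∧ ‖v L x‖ ≤ 1) ∧ ∀ L', L ≤ L' →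
      ‖u L' x - u L x‖ ≤ √(2 * C / L) ∧ ‖v L' x - v L x‖ ≤ √(2 * C / L) := by
  have hC0 : 0 ≤ C := by simpa using hC 0 le_rfl
  refine ⟨le_of_sq_add_sq_le zero_le_one ?_, fun L' hL' => le_of_sq_add_sq_le (by positivity) ?_⟩
  · have := (h L).energy_mono hz hxL
    simpa [hu, hv] using this
  · rw [Real.sq_sqrt (by positivity)]
    -- The difference of the two solutions is itself a solution, so its energy at `x` is controlled
    -- by that at `L`, where the solution for `L` equals `(0, 1)`.
    refine (((h L').sub (h L)).energy_mono hz hxL).trans ?_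
    rw [hu L, hv L, sub_zero]
    exact (h L').energy_sub_one_le hz hC hL hL' (hu L') (hv L')

section Gauge

variable {p : ℝ → ℂ} {B : ℝ}

lemma hasDerivAt_cexp_const_mul_sub (w : ℂ) (y x : ℝ) :
    HasDerivAt (fun x : ℝ => Complex.exp (w * ((y : ℂ) - x)))
      (-w * Complex.exp (w * ((y : ℂ) - x))) x := by
  have h : HasDerivAt (fun x : ℝ => w * ((y : ℂ) - x)) (w * (-1)) x :=
    ((Complex.ofRealCLM.hasDerivAt (x := x)).const_sub (y : ℂ)).const_mul w
  exact h.cexp.congr_deriv (by ring)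

lemma isGaugedSolution_right (hp : Continuous p) (hB : ∀ x, ‖p x‖ ≤ B) (z : ℂ) (y : ℝ)
    (j : Fin 2) :
    IsGaugedSolution p z
      (fun x => Complex.exp (Complex.I * z * ((y : ℂ) - x)) * transition p x y z 0 j)
      (fun x => Complex.exp (Complex.I * z * ((y : ℂ) - x)) * transition p x y z 1 j) where
  fst x := ((hasDerivAt_cexp_const_mul_sub _ y x).mul
    (hasDerivAt_transition_zero hp hB y x z j)).congr_deriv (by ring)
  snd x := ((hasDerivAt_cexp_const_mul_sub _ y x).mul
    (hasDerivAt_transition_one hp hB y x z j)).congr_deriv (by ring)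

/-- The opposite exponential removes the other diagonal entry. With the components exchanged, the
system has the same form with potential `-p^*` and parameter `-z`. -/
lemma isGaugedSolution_left (hp : Continuous p) (hB : ∀ x, ‖p x‖ ≤ B) (z : ℂ) (y : ℝ)
    (j : Fin 2) :
    IsGaugedSolution (fun x => -(starRingEnd ℂ) (p x)) (-z)
      (fun x => Complex.exp (-(Complex.I * z) * ((y : ℂ) - x)) * transition p x y z 1 j)
      (fun x => Complex.exp (-(Complex.I * z) * ((y : ℂ) - x)) * transition p x y z 0 j) where
  fst x := ((hasDerivAt_cexp_const_mul_sub _ y x).mul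
    (hasDerivAt_transition_one hp hB y x z j)).congr_deriv (by ring)
  snd x := ((hasDerivAt_cexp_const_mul_sub _ y x).mul
    (hasDerivAt_transition_zero hp hB y x z j)).congr_deriv (by simp; ring)

end Gauge

/-! ### Bounded analytic functions on the half-planes -/

lemma closure_upperPlane : closure upperPlane = {z | 0 ≤ z.im} := Complex.closure_setOfPred_lt_im 0

lemma closure_lowerPlane : closure lowerPlane = {z | z.im ≤ 0} := Complex.closure_setOfPred_im_lt 0

lemma isOpen_upperPlane : IsOpen upperPlane := isOpen_lt continuous_const Complex.continuous_im

lemma isOpen_lowerPlane : IsOpen lowerPlane := isOpen_lt Complex.continuous_im continuous_const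

lemma exists_isBoundedAnalytic_limit {S : Set ℂ} (hS : IsOpen S) {V : ℝ → ℂ → Fin 2 → ℂ}
    (hV : ∀ L, Differentiable ℂ (V L)) {L₀ b : ℝ} {e : ℝ → ℝ} (he : Tendsto e atTop (𝓝 0))
    (hb : ∀ L, L₀ ≤ L → ∀ z ∈ closure S, ‖V L z‖ ≤ b)
    (hc : ∀ L, L₀ ≤ L → ∀ L', L ≤ L' → ∀ z ∈ closure S, ‖V L' z - V L z‖ ≤ e L) :
    ∃ W, IsBoundedAnalytic S W ∧
      ∀ z ∈ closure S, Tendsto (fun L => V L z) atTop (𝓝 (W z)) := by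
  have hcau : UniformCauchySeqOn V atTop (closure S) := by
    refine Metric.uniformCauchySeqOn_iff.2 fun δ hδ => ?_
    obtain ⟨L₁, hL₁, hL₁'⟩ := ((he.eventually (gt_mem_nhds (half_pos hδ))).and
      (eventually_ge_atTop L₀)).exists
    refine ⟨L₁, fun m hm n hn z hz => ?_⟩
    calc dist (V m z) (V n z) ≤ dist (V m z) (V L₁ z) + dist (V n z) (V L₁ z) :=
          dist_triangle_right _ _ _
      _ < δ / 2 + δ / 2 := by
          rw [dist_eq_norm, dist_eq_norm]
          exact add_lt_add ((hc L₁ hL₁' m hm z hz).trans_lt hL₁)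
            ((hc L₁ hL₁' n hn z hz).trans_lt hL₁)
      _ = δ := add_halves δ
  -- The implication allows an arbitrary value off the closure, so that the chosen limit is a total
  -- function.
  have hex : ∀ z, ∃ w, z ∈ closure S → Tendsto (fun L => V L z) atTop (𝓝 w) := by
    intro z
    by_cases hz : z ∈ closure S
    · obtain ⟨w, hw⟩ := cauchy_map_iff_exists_tendsto.1 (hcau.cauchy_map hz)
      exact ⟨w, fun _ => hw⟩
    · exact ⟨0, fun h => absurd h hz⟩
  choose W hW using hex
  have hunif : TendstoUniformlyOn V W atTop (closure S) :=
    hcau.tendstoUniformlyOn_of_tendsto fun z hz => hW z hz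
  refine ⟨W, ⟨?_, ?_, b, fun z hz => ?_⟩, hW⟩
  · refine DifferentiableOn.analyticOnNhd ?_ hS
    exact (hunif.mono subset_closure).tendstoLocallyUniformlyOn.differentiableOn
      (Eventually.of_forall fun L => (hV L).differentiableOn) hS
  · exact hunif.continuousOn (Frequently.of_forall fun L => (hV L).continuous.continuousOn)
  · exact le_of_tendsto (hW z hz).norm
      ((eventually_ge_atTop L₀).mono fun L hL => hb L hL z hz)

/-! ### The Jost solutions at infinity -/

section Jost

variable {p : ℝ → ℂ} {B C : ℝ}

lemma tendsto_sqrt_div_atTop (C : ℝ) : Tendsto (fun L : ℝ => √(2 * C / L)) atTop (𝓝 0) := by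
  simpa using (tendsto_id.const_div_atTop (2 * C)).sqrt

lemma exists_upper_jost (hp : Continuous p) (hB : ∀ x, ‖p x‖ ≤ B)
    (hC : ∀ x, 0 ≤ x → x ^ 2 * ‖p x‖ ≤ C) (x : ℝ) :
    ∃ W, IsBoundedAnalytic upperPlane W ∧ ∀ z : ℂ, 0 ≤ z.im → Tendsto
      (fun (L : ℝ) i => Complex.exp (Complex.I * z * ((L : ℂ) - x)) * transition p x L z i 1)
      atTop (𝓝 (W z)) := by
  -- The threshold `max x 1` ensures both `x ≤ L` and `0 < L`.
  have key : ∀ z ∈ closure upperPlane, ∀ L, max x 1 ≤ L → _ := fun z hz L hL =>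
    gaugedSolution_bounds (fun L => isGaugedSolution_right hp hB z L 1)
      (by simp [transition_self hB]) (by simp [transition_self hB])
      (by rwa [closure_upperPlane] at hz) hC (x := x)
      (zero_lt_one.trans_le ((le_max_right _ _).trans hL)) ((le_max_left _ _).trans hL)
  obtain ⟨W, hW, hlim⟩ := exists_isBoundedAnalytic_limit isOpen_upperPlane
    (V := fun (L : ℝ) z i =>
      Complex.exp (Complex.I * z * ((L : ℂ) - x)) * transition p x L z i 1)
    (fun L => differentiable_pi.2 fun i => by
      have := differentiable_transition hp hB x L i 1
      fun_prop) (tendsto_sqrt_div_atTop C)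
    (fun L hL z hz => (pi_norm_le_iff_of_nonneg zero_le_one).2 fun i => by
      fin_cases i
      exacts [(key z hz L hL).1.1, (key z hz L hL).1.2])
    (fun L hL L' hL' z hz => (pi_norm_le_iff_of_nonneg (Real.sqrt_nonneg _)).2 fun i => by
      fin_cases i
      exacts [((key z hz L hL).2 L' hL').1, ((key z hz L hL).2 L' hL').2])
  exact ⟨W, hW, fun z hz => hlim z (by rwa [closure_upperPlane])⟩

lemma exists_lower_jost (hp : Continuous p) (hB : ∀ x, ‖p x‖ ≤ B)
    (hC : ∀ x, 0 ≤ x → x ^ 2 * ‖p x‖ ≤ C) (x : ℝ) :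
    ∃ W, IsBoundedAnalytic lowerPlane W ∧ ∀ z : ℂ, z.im ≤ 0 → Tendsto
      (fun (L : ℝ) i => Complex.exp (-(Complex.I * z) * ((L : ℂ) - x)) * transition p x L z i 0)
      atTop (𝓝 (W z)) := by
  have key : ∀ z ∈ closure lowerPlane, ∀ L, max x 1 ≤ L → _ := fun z hz L hL =>
    gaugedSolution_bounds (C := C) (fun L => isGaugedSolution_left hp hB z L 0)
      (by simp [transition_self hB]) (by simp [transition_self hB])
      (by rw [closure_lowerPlane] at hz; simpa using hz) (by simpa using hC) (x := x)
      (zero_lt_one.trans_le ((le_max_right _ _).trans hL)) ((le_max_left _ _).trans hL)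
  obtain ⟨W, hW, hlim⟩ := exists_isBoundedAnalytic_limit isOpen_lowerPlane
    (V := fun (L : ℝ) z i =>
      Complex.exp (-(Complex.I * z) * ((L : ℂ) - x)) * transition p x L z i 0)
    (fun L => differentiable_pi.2 fun i => by
      have := differentiable_transition hp hB x L i 0
      fun_prop) (tendsto_sqrt_div_atTop C)
    (fun L hL z hz => (pi_norm_le_iff_of_nonneg zero_le_one).2 fun i => by
      fin_cases i
      exacts [(key z hz L hL).1.2, (key z hz L hL).1.1])
    (fun L hL L' hL' z hz => (pi_norm_le_iff_of_nonneg (Real.sqrt_nonneg _)).2 fun i => by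
      fin_cases i
      exacts [((key z hz L hL).2 L' hL').2, ((key z hz L hL).2 L' hL').1])
  exact ⟨W, hW, fun z hz => hlim z (by rwa [closure_lowerPlane])⟩

end Jost

/-! ### The inverse of the transition matrix at real spectral parameter -/

namespace IsGaugedSolution

variable {p : ℝ → ℂ} {z : ℂ} {u v u' v' : ℝ → ℂ}

lemma add (h : IsGaugedSolution p z u v) (h' : IsGaugedSolution p z u' v') :
    IsGaugedSolution p z (fun x => u x + u' x) (fun x => v x + v' x) where
  fst x := ((h.fst x).add (h'.fst x)).congr_deriv (by ring)
  snd x := ((h.snd x).add (h'.snd x)).congr_deriv (by ring)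

lemma mul_const (h : IsGaugedSolution p z u v) (c : ℂ) :
    IsGaugedSolution p z (fun x => u x * c) (fun x => v x * c) where
  fst x := ((h.fst x).mul_const c).congr_deriv (by ring)
  snd x := ((h.snd x).mul_const c).congr_deriv (by ring)

lemma eq_zero (h : IsGaugedSolution p z u v) (hz : z.im = 0) {y : ℝ} (hu : u y = 0)
    (hv : v y = 0) (x : ℝ) : u x = 0 ∧ v x = 0 := by
  have hle : ‖u x‖ ^ 2 + ‖v x‖ ^ 2 ≤ 0 ^ 2 := by
    rcases le_total x y with hxy | hxy
    · simpa [hu, hv] using h.energy_mono hz.ge hxy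
    · simpa [hu, hv] using h.energy_anti hz.le hxy
  have := le_of_sq_add_sq_le le_rfl hle
  exact ⟨norm_le_zero_iff.1 this.1, norm_le_zero_iff.1 this.2⟩

end IsGaugedSolution

/-- For real `z` the energy is conserved, which gives uniqueness. Two solutions that agree at `y`
are compared at `x`; the constant `exp(iz(y - x))` reconciles the gauges based at `y` and at `x`. -/
lemma transition_mul_transition {p : ℝ → ℂ} {B : ℝ} (hp : Continuous p) (hB : ∀ x, ‖p x‖ ≤ B)
    (x y : ℝ) {z : ℂ} (hz : z.im = 0) : transition p x y z * transition p y x z = 1 := by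
  have he : Complex.exp (Complex.I * z * x - Complex.I * z * y) *
      Complex.exp (Complex.I * z * y - Complex.I * z * x) = 1 := by
    rw [← Complex.exp_add]
    simp
  have key : ∀ j, _ := fun j =>
    ((((isGaugedSolution_right hp hB z y 0).mul_const (transition p y x z 0 j)).add
      ((isGaugedSolution_right hp hB z y 1).mul_const (transition p y x z 1 j))).sub
      ((isGaugedSolution_right hp hB z x j).mul_const
        (Complex.exp (Complex.I * z * ((y : ℂ) - x))))).eq_zero hz (y := y)
      (by simp [transition_self hB, mul_sub]; linear_combination -transition p y x z 0 j * he)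
      (by simp [transition_self hB, mul_sub]; linear_combination -transition p y x z 1 j * he) x
  ext i j
  have h := key j
  simp only [transition_self hB, sub_self, mul_zero, Complex.exp_zero, one_mul, mul_assoc,
    ← mul_add, sub_eq_zero] at h
  rw [Matrix.mul_apply, Fin.sum_univ_two]
  have hne := Complex.exp_ne_zero (Complex.I * (z * ((y : ℂ) - x)))
  fin_cases i
  · exact mul_left_cancel₀ hne (h.1.trans (mul_comm _ _))
  · exact mul_left_cancel₀ hne (h.2.trans (mul_comm _ _))

/-! ### Calculus of bounded analytic functions -/

/-- The scalar version of `IsBoundedAnalytic`. -/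
def IsBoundedAnalyticFun (S : Set ℂ) (h : ℂ → ℂ) : Prop :=
  AnalyticOnNhd ℂ h S ∧ ContinuousOn h (closure S) ∧ ∃ B : ℝ, ∀ z ∈ closure S, ‖h z‖ ≤ B

namespace IsBoundedAnalyticFun

variable {S : Set ℂ} {h k : ℂ → ℂ}

lemma add (hh : IsBoundedAnalyticFun S h) (hk : IsBoundedAnalyticFun S k) :
    IsBoundedAnalyticFun S fun z => h z + k z := by
  obtain ⟨h1, h2, B, h3⟩ := hh
  obtain ⟨k1, k2, D, k3⟩ := hk
  exact ⟨fun z hz => (h1 z hz).fun_add (k1 z hz), h2.add k2, B + D, fun z hz =>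
    (norm_add_le _ _).trans (add_le_add (h3 z hz) (k3 z hz))⟩

lemma mul (hh : IsBoundedAnalyticFun S h) (hk : IsBoundedAnalyticFun S k) :
    IsBoundedAnalyticFun S fun z => h z * k z := by
  obtain ⟨h1, h2, B, h3⟩ := hh
  obtain ⟨k1, k2, D, k3⟩ := hk
  refine ⟨fun z hz => (h1 z hz).fun_mul (k1 z hz), h2.mul k2, B * D, fun z hz => ?_⟩
  rw [norm_mul]
  exact mul_le_mul (h3 z hz) (k3 z hz) (norm_nonneg _) ((norm_nonneg _).trans (h3 z hz))

lemma of_differentiableAt {B : ℝ} (hS : IsOpen S)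
    (hd : ∀ z ∈ closure S, DifferentiableAt ℂ h z) (hB : ∀ z ∈ closure S, ‖h z‖ ≤ B) :
    IsBoundedAnalyticFun S h :=
  ⟨DifferentiableOn.analyticOnNhd
    (fun z hz => (hd z (subset_closure hz)).differentiableWithinAt) hS,
    fun z hz => (hd z hz).continuousAt.continuousWithinAt, B, hB⟩

lemma const_mul (c : ℂ) (hh : IsBoundedAnalyticFun S h) :
    IsBoundedAnalyticFun S fun z => c * h z :=
  mul ⟨analyticOnNhd_const, continuousOn_const, ‖c‖, fun _ _ => le_rfl⟩ hh

lemma comp_neg {S' : Set ℂ} (hh : IsBoundedAnalyticFun S h) (hm : Set.MapsTo Neg.neg S' S)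
    (hm' : Set.MapsTo Neg.neg (closure S') (closure S)) :
    IsBoundedAnalyticFun S' fun z => h (-z) := by
  obtain ⟨h1, h2, B, h3⟩ := hh
  exact ⟨h1.comp analyticOnNhd_id.neg hm, h2.comp continuousOn_neg hm', B,
    fun z hz => h3 _ (hm' hz)⟩

lemma neg_lower (hh : IsBoundedAnalyticFun lowerPlane h) :
    IsBoundedAnalyticFun upperPlane fun z => h (-z) :=
  hh.comp_neg (fun z hz => by simpa [upperPlane, lowerPlane] using hz)
    fun z hz => by simpa [closure_upperPlane, closure_lowerPlane] using hz

lemma neg_upper (hh : IsBoundedAnalyticFun upperPlane h) :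
    IsBoundedAnalyticFun lowerPlane fun z => h (-z) :=
  hh.comp_neg (fun z hz => by simpa [upperPlane, lowerPlane] using hz)
    fun z hz => by simpa [closure_upperPlane, closure_lowerPlane] using hz

end IsBoundedAnalyticFun

lemma isBoundedAnalytic_iff {S : Set ℂ} {v : ℂ → Fin 2 → ℂ} :
    IsBoundedAnalytic S v ↔ ∀ i, IsBoundedAnalyticFun S fun z => v z i := by
  constructor
  · rintro ⟨h1, h2, B, h3⟩ i
    exact ⟨fun z hz => analyticAt_pi_iff.1 (h1 z hz) i, continuousOn_pi.1 h2 i, B,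
      fun z hz => (norm_le_pi_norm _ i).trans (h3 z hz)⟩
  · intro h
    choose h1 h2 B h3 using h
    refine ⟨fun z hz => analyticAt_pi_iff.2 fun i => h1 i z hz, continuousOn_pi.2 h2,
      max (B 0) (B 1), fun z hz => ?_⟩
    refine (pi_norm_le_iff_of_nonempty _).2 fun i => ?_
    fin_cases i
    exacts [(h3 0 z hz).trans (le_max_left _ _), (h3 1 z hz).trans (le_max_right _ _)]

lemma isBoundedAnalytic_mulVec {S : Set ℂ} {A : ℂ → Mat2} {v : ℂ → Fin 2 → ℂ}
    (hA : ∀ i j, IsBoundedAnalyticFun S fun z => A z i j)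
    (hv : ∀ i, IsBoundedAnalyticFun S fun z => v z i) (i : Fin 2) :
    IsBoundedAnalyticFun S fun z => (A z).mulVec (v z) i := by
  simp only [Matrix.mulVec, dotProduct, Fin.sum_univ_two]
  exact ((hA i 0).mul (hv 0)).add ((hA i 1).mul (hv 1))

section Transition

variable {p : ℝ → ℂ} {B : ℝ}

lemma sum_sq_norm_one_col :
    ∀ j : Fin 2, ‖(1 : Mat2) 0 j‖ ^ 2 + ‖(1 : Mat2) 1 j‖ ^ 2 ≤ 1 ^ 2 :=
  Fin.forall_fin_two.2 (by simp)

lemma isBoundedAnalyticFun_upper_transition (hp : Continuous p) (hB : ∀ x, ‖p x‖ ≤ B) {x : ℝ}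
    (hx : 0 ≤ x) (i j : Fin 2) : IsBoundedAnalyticFun upperPlane
      fun z => Complex.exp (Complex.I * z * x) * transition p x 0 z i j := by
  have hd := differentiable_transition hp hB x 0 i j
  refine .of_differentiableAt (B := 1) isOpen_upperPlane (fun z _ => by fun_prop) fun z hz => ?_
  rw [closure_upperPlane] at hz
  have h := (isGaugedSolution_left hp hB z 0 j).energy_anti (by simpa using hz) hx
  simp only [transition_self hB, Complex.ofReal_zero, zero_sub, neg_mul_neg, sub_self, mul_zero,
    Complex.exp_zero, one_mul] at h
  have := le_of_sq_add_sq_le zero_le_one (h.trans ((add_comm _ _).trans_le (sum_sq_norm_one_col j)))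
  fin_cases i
  exacts [this.2, this.1]

lemma isBoundedAnalyticFun_lower_transition (hp : Continuous p) (hB : ∀ x, ‖p x‖ ≤ B) {x : ℝ}
    (hx : 0 ≤ x) (i j : Fin 2) : IsBoundedAnalyticFun lowerPlane
      fun z => Complex.exp (-(Complex.I * z * x)) * transition p x 0 z i j := by
  have hd := differentiable_transition hp hB x 0 i j
  refine .of_differentiableAt (B := 1) isOpen_lowerPlane (fun z _ => by fun_prop) fun z hz => ?_
  rw [closure_lowerPlane] at hz
  have h := (isGaugedSolution_right hp hB z 0 j).energy_anti hz hx
  simp only [transition_self hB, Complex.ofReal_zero, zero_sub, mul_neg, neg_zero, mul_zero,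
    Complex.exp_zero, one_mul] at h
  have := le_of_sq_add_sq_le zero_le_one (h.trans (sum_sq_norm_one_col j))
  fin_cases i
  exacts [this.1, this.2]

end Transition

/-! ### The rational factor -/

lemma norm_eval_le_one_add_norm_pow {P : ℂ[X]} {n : ℕ} (hP : P.natDegree ≤ n) (z : ℂ) :
    ‖P.eval z‖ ≤ (∑ k ∈ Finset.range (n + 1), ‖P.coeff k‖) * (1 + ‖z‖) ^ n := by
  rw [Polynomial.eval_eq_sum_range' (Nat.lt_succ_of_le hP), Finset.sum_mul]
  refine norm_sum_le_of_le _ fun k hk => ?_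
  rw [norm_mul, norm_pow]
  gcongr
  calc ‖z‖ ^ k ≤ (1 + ‖z‖) ^ k := by gcongr; linarith
    _ ≤ (1 + ‖z‖) ^ n := by
      gcongr
      · linarith [norm_nonneg z]
      · exact Nat.lt_succ_iff.1 (Finset.mem_range.1 hk)

/-- Two lower bounds for `|z - r|` are combined: `Im r`, which absorbs `1 + |r|`, and `|z| - |r|`.
-/
lemma one_add_norm_le_mul_norm_sub {r z : ℂ} (hr : 0 < r.im) (hz : z.im ≤ 0) :
    1 + ‖z‖ ≤ ((1 + ‖r‖) / r.im + 1) * ‖z - r‖ := by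
  have h1 : r.im ≤ ‖z - r‖ := by
    have := Complex.abs_im_le_norm (z - r)
    rw [Complex.sub_im, abs_of_nonpos (by linarith)] at this
    linarith
  have h2 : ‖z‖ ≤ ‖z - r‖ + ‖r‖ := by simpa using norm_add_le (z - r) r
  have h3 : 1 + ‖r‖ ≤ (1 + ‖r‖) / r.im * ‖z - r‖ := by
    rw [div_mul_eq_mul_div, le_div_iff₀ hr]
    gcongr
  linarith

namespace KappaData

variable (d : KappaData)

lemma eval_f (z : ℂ) : d.f.eval z =
    (∏ j, ((z - d.β j) * (z + (starRingEnd ℂ) (d.β j)))) * ∏ l, (z - Complex.I * d.α l) := by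
  simp [f, Polynomial.eval_prod]

lemma eval_g (z : ℂ) : d.g.eval z =
    (∏ j, ((z - (starRingEnd ℂ) (d.β j)) * (z - -d.β j))) * ∏ l, (z - -(Complex.I * d.α l)) := by
  simp [g, f, Polynomial.eval_prod, Polynomial.map_prod]

/-- Negation carries the roots of `f` to those of `g`. The signs from the `β` factors pair off, and
each `α` factor leaves one `-1`. -/
lemma eval_f_eq (z : ℂ) : d.f.eval z = (-1) ^ d.M * d.g.eval (-z) := by
  rw [eval_f, eval_g, mul_left_comm]
  congr 1
  · exact Finset.prod_congr rfl fun j _ => by ring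
  · have hsign : (-1 : ℂ) ^ d.M = ∏ _l : Fin d.M, (-1) := by simp
    rw [hsign, ← Finset.prod_mul_distrib]
    exact Finset.prod_congr rfl fun l _ => by ring

variable {d}

lemma im_β_neg (hd : ∀ z ∈ d.zeros, z.im < 0) (j : Fin d.N) : (d.β j).im < 0 := by
  refine hd _ ?_
  change d.f.eval _ = 0
  rw [eval_f, Finset.prod_eq_zero (Finset.mem_univ j) (by simp), zero_mul]

lemma α_neg (hd : ∀ z ∈ d.zeros, z.im < 0) (l : Fin d.M) : d.α l < 0 := by
  have : (Complex.I * d.α l).im < 0 := by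
    refine hd _ ?_
    change d.f.eval _ = 0
    rw [eval_f, Finset.prod_eq_zero (Finset.mem_univ l) (sub_self _), mul_zero]
  simpa using this

/-- Every root of `g` lies in the open upper half-plane, so each linear factor is comparable to `1 +
|z|` below. This yields both the absence of poles and the boundedness of polynomials of degree at
most `2N + M` divided by `g`. -/
lemma exists_pow_le_norm_eval_g (hd : ∀ z ∈ d.zeros, z.im < 0) :
    ∃ c : ℝ, ∀ z : ℂ, z.im ≤ 0 → (1 + ‖z‖) ^ (2 * d.N + d.M) ≤ c * ‖d.g.eval z‖ := by
  let c : ℂ → ℝ := fun r => (1 + ‖r‖) / r.im + 1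
  refine ⟨(∏ j, (c ((starRingEnd ℂ) (d.β j)) * c (-d.β j))) * ∏ l, c (-(Complex.I * d.α l)),
    fun z hz => ?_⟩
  have h0 : 0 ≤ 1 + ‖z‖ := by positivity
  have h1 : ∀ j, 1 + ‖z‖ ≤ c ((starRingEnd ℂ) (d.β j)) * ‖z - (starRingEnd ℂ) (d.β j)‖ :=
    fun j => one_add_norm_le_mul_norm_sub (by simpa using im_β_neg hd j) hz
  have h2 : ∀ j, 1 + ‖z‖ ≤ c (-d.β j) * ‖z - -d.β j‖ :=
    fun j => one_add_norm_le_mul_norm_sub (by simpa using im_β_neg hd j) hz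
  have h3 : ∀ l, 1 + ‖z‖ ≤ c (-(Complex.I * d.α l)) * ‖z - -(Complex.I * d.α l)‖ :=
    fun l => one_add_norm_le_mul_norm_sub (by simpa using α_neg hd l) hz
  calc (1 + ‖z‖) ^ (2 * d.N + d.M)
      = (∏ _j : Fin d.N, ((1 + ‖z‖) * (1 + ‖z‖))) * ∏ _l : Fin d.M, (1 + ‖z‖) := by
        simp only [Finset.prod_const, Finset.card_univ, Fintype.card_fin]
        rw [pow_add, pow_mul, sq]
    _ ≤ (∏ j, (c ((starRingEnd ℂ) (d.β j)) * ‖z - (starRingEnd ℂ) (d.β j)‖ *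
          (c (-d.β j) * ‖z - -d.β j‖))) *
          ∏ l, (c (-(Complex.I * d.α l)) * ‖z - -(Complex.I * d.α l)‖) := by
        have hA := Finset.prod_le_prod (s := Finset.univ) (fun j _ => mul_nonneg h0 h0)
          fun j _ => mul_le_mul (h1 j) (h2 j) h0 (h0.trans (h1 j))
        have hB := Finset.prod_le_prod (s := Finset.univ) (fun l _ => h0) fun l _ => h3 l
        exact mul_le_mul hA hB (Finset.prod_nonneg fun l _ => h0)
          ((Finset.prod_nonneg fun j _ => mul_nonneg h0 h0).trans hA)
    _ = _ := by
        rw [eval_g, norm_mul, norm_prod, norm_prod]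
        simp only [norm_mul, Finset.prod_mul_distrib]
        ring

lemma eval_g_ne_zero (hd : ∀ z ∈ d.zeros, z.im < 0) {z : ℂ} (hz : z.im ≤ 0) :
    d.g.eval z ≠ 0 := by
  obtain ⟨c, hc⟩ := exists_pow_le_norm_eval_g hd
  intro h
  have h1 := hc z hz
  rw [h, norm_zero, mul_zero] at h1
  have : 0 < (1 + ‖z‖) ^ (2 * d.N + d.M) := by positivity
  exact absurd h1 this.not_ge

lemma isBoundedAnalyticFun_inv_eval_g_mul (hd : ∀ z ∈ d.zeros, z.im < 0) {P : ℂ[X]}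
    (hP : P.natDegree ≤ 2 * d.N + d.M) :
    IsBoundedAnalyticFun lowerPlane fun z => (d.g.eval z)⁻¹ * P.eval z := by
  obtain ⟨c, hc⟩ := exists_pow_le_norm_eval_g hd
  set D := ∑ k ∈ Finset.range (2 * d.N + d.M + 1), ‖P.coeff k‖
  have hD : 0 ≤ D := Finset.sum_nonneg fun _ _ => norm_nonneg _
  refine .of_differentiableAt (B := D * c) isOpen_lowerPlane (fun z hz => ?_) fun z hz => ?_
  · rw [closure_lowerPlane] at hz
    exact (d.g.differentiable z).inv (eval_g_ne_zero hd hz) |>.mul (P.differentiable z)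
  · rw [closure_lowerPlane] at hz
    have hg : 0 < ‖d.g.eval z‖ := norm_pos_iff.2 (eval_g_ne_zero hd hz)
    rw [norm_mul, norm_inv, inv_mul_le_iff₀ hg]
    calc ‖P.eval z‖ ≤ D * (1 + ‖z‖) ^ (2 * d.N + d.M) := norm_eval_le_one_add_norm_pow hP z
      _ ≤ D * (c * ‖d.g.eval z‖) := by gcongr; exact hc z hz
      _ = _ := by ring

end KappaData

/-! ### Limits of the approximate Jost solutions -/

lemma expSigma3_mul (a b : ℂ) : expSigma3 a * expSigma3 b = expSigma3 (a + b) := by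
  ext i j
  fin_cases i <;> fin_cases j <;>
    simp [expSigma3, Matrix.mul_apply, Fin.sum_univ_two, Complex.exp_add, mul_comm]

lemma expSigma3_zero : expSigma3 0 = 1 := by
  ext i j
  fin_cases i <;> fin_cases j <;> simp [expSigma3]

lemma exists_tendsto_approxF {p : ℝ → ℂ} {B C : ℝ} (hp : Continuous p) (hB : ∀ x, ‖p x‖ ≤ B)
    (hC : ∀ x, 0 ≤ x → x ^ 2 * ‖p x‖ ≤ C) (x : ℝ) :
    ∃ Xm Xp : ℂ → Fin 2 → ℂ, IsBoundedAnalytic lowerPlane Xm ∧ IsBoundedAnalytic upperPlane Xp ∧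
      ∀ k : ℝ, Tendsto (approxF p x k) atTop
        (𝓝 (ofCols (Xm k) (Xp k) * expSigma3 (-Complex.I * k * x))) := by
  obtain ⟨Xm, hm, hm'⟩ := exists_lower_jost hp hB hC x
  obtain ⟨Xp, hp₁, hp'⟩ := exists_upper_jost hp hB hC x
  refine ⟨Xm, Xp, hm, hp₁, fun k => ?_⟩
  have h1 := hm' k (by simp)
  have h2 := hp' k (by simp)
  have hcont : Continuous fun w : (Fin 2 → ℂ) × (Fin 2 → ℂ) => ofCols w.1 w.2 := by
    refine continuous_matrix fun i j => ?_
    fin_cases i <;> fin_cases j <;> simp [ofCols] <;> fun_prop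
  refine (((hcont.tendsto _).comp (h1.prodMk_nhds h2)).mul_const
    (expSigma3 (-Complex.I * k * x))).congr fun L => ?_
  have e1 : Complex.exp (-(Complex.I * k * L)) = Complex.exp (-(Complex.I * k) * (L - x)) *
      Complex.exp (-(Complex.I * k * x)) := by rw [← Complex.exp_add]; ring_nf
  have e2 : Complex.exp (Complex.I * k * L) = Complex.exp (Complex.I * k * (L - x)) *
      Complex.exp (Complex.I * k * x) := by rw [← Complex.exp_add]; ring_nf
  ext i j
  fin_cases i <;> fin_cases j <;>
    simp [approxF, ofCols, expSigma3, Matrix.mul_apply, Fin.sum_univ_two, e1, e2] <;> ring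

/-- The factor `κ` meets only the second column, where it is merged with `K` into `R`, so that the
poles can cancel before the column is continued. -/
lemma mul_ofCols_mul_diag {A K R : Mat2} {κ : ℂ} (hR : κ • K = R) (u v : Fin 2 → ℂ) (w : ℂ) :
    A * K * ofCols u v * !![1, 0; 0, κ] * expSigma3 w =
      ofCols ((Complex.exp w • A).mulVec (K.mulVec u))
        ((Complex.exp (-w) • A).mulVec (R.mulVec v)) := by
  subst hR
  ext i j
  fin_cases i <;> fin_cases j <;>
    simp [ofCols, expSigma3, Matrix.mul_apply, Matrix.mulVec, dotProduct, Fin.sum_univ_two] <;> ring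

lemma transition_congr {q p : ℝ → ℂ} (h : ∀ x, 0 ≤ x → q x = p x) {x y : ℝ} (hx : 0 ≤ x)
    (hy : 0 ≤ y) (z : ℂ) : transition q x y z = transition p x y z :=
  orderedExp_congr Set.ordConnected_Ici (s := Set.Ici 0)
    (fun ξ hξ => by simp only [laxU, potQ, h ξ hξ]) hx hy

/-- The estimates above concern potentials on the whole line. Freezing `q` at `q 0` on the negative
axis changes no transition matrix between nonnegative points. -/
lemma IsSchwartzHalfLine.exists_extension {q : ℝ → ℂ} (hq : IsSchwartzHalfLine q) :
    ∃ (p : ℝ → ℂ) (B C : ℝ), Continuous p ∧ (∀ x, ‖p x‖ ≤ B) ∧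
      (∀ x, 0 ≤ x → x ^ 2 * ‖p x‖ ≤ C) ∧ ∀ x, 0 ≤ x → q x = p x := by
  obtain ⟨B, hB⟩ := hq.2 0 0
  obtain ⟨C, hC⟩ := hq.2 2 0
  simp only [iteratedDerivWithin_zero, pow_zero, one_mul] at hB hC
  refine ⟨fun x => q (max x 0), B, C, ?_, fun x => hB _ (le_max_right _ _), fun x hx => ?_,
    fun x hx => ?_⟩
  · exact hq.1.continuousOn.comp_continuous (by fun_prop) fun x =>
      Set.mem_Ici.2 (le_max_right _ _)
  · simpa [max_eq_left hx] using hC x hx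
  · simp [max_eq_left hx]

end HalfLineNLS

end

theorem mainTheorem5 (d : HalfLineNLS.KappaData) (hd : ∀ z ∈ d.zeros, z.im < 0)
    (K : ℂ → HalfLineNLS.Mat2) (hK : HalfLineNLS.IsReflectionMatrix d K)
    (q : ℝ → ℂ) (hq : HalfLineNLS.IsSchwartzHalfLine q) (x : ℝ) (hx : 0 ≤ x) :
    (∀ k : ℝ,
      Tendsto (HalfLineNLS.approxF q x (k : ℂ)) atTop (𝓝 (HalfLineNLS.jostF q x (k : ℂ))) ∧
      Tendsto (HalfLineNLS.approxG q d K x (k : ℂ)) atTop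
        (𝓝 (HalfLineNLS.jostG q d K x (k : ℂ)))) ∧
    ∃ Xm Xp Yp Ym : ℂ → Fin 2 → ℂ,
      (∀ k : ℝ, HalfLineNLS.modX q x (k : ℂ) = HalfLineNLS.ofCols (Xm (k : ℂ)) (Xp (k : ℂ))) ∧
      (∀ k : ℝ, HalfLineNLS.modY q d K x (k : ℂ) =
        HalfLineNLS.ofCols (Yp (k : ℂ)) (Ym (k : ℂ))) ∧
      HalfLineNLS.IsBoundedAnalytic HalfLineNLS.upperPlane Xp ∧
      HalfLineNLS.IsBoundedAnalytic HalfLineNLS.upperPlane Yp ∧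
      HalfLineNLS.IsBoundedAnalytic HalfLineNLS.lowerPlane Xm ∧
      HalfLineNLS.IsBoundedAnalytic HalfLineNLS.lowerPlane Ym := by
  open HalfLineNLS in
  obtain ⟨p, B, C, hp, hB, hC, hqp⟩ := hq.exists_extension
  obtain ⟨Xm, Xp, hXm, hXp, hX⟩ := exists_tendsto_approxF hp hB hC x
  obtain ⟨Zm, Zp, hZm, hZp, hZ⟩ := exists_tendsto_approxF hp hB hC 0
  obtain ⟨P, hPdeg, hP⟩ := hK.rational
  have hF : ∀ k : ℝ, Tendsto (approxF q x k) atTop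
      (𝓝 (ofCols (Xm k) (Xp k) * expSigma3 (-Complex.I * k * x))) := fun k =>
    (hX k).congr' <| (eventually_ge_atTop 0).mono fun L hL => by
      simp only [approxF, transition_congr hqp hx hL]
  have hG : ∀ k : ℝ, Tendsto (approxG q d K x k) atTop
      (𝓝 (transition p x 0 k * K (-k) * ofCols (Zm (-k)) (Zp (-k)) * d.Kplus k)) := by
    intro k
    have h := hZ (-k)
    simp only [Complex.ofReal_neg, Complex.ofReal_zero, mul_zero, expSigma3_zero, mul_one] at h
    refine ((h.const_mul (transition p x 0 k * K (-k))).mul_const (d.Kplus k)).congr' <|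
      (eventually_ge_atTop 0).mono fun L hL => ?_
    have hinv : (transition p L 0 (-k))⁻¹ = transition p 0 L (-k) :=
      Matrix.inv_eq_right_inv (transition_mul_transition hp hB L 0 (by simp))
    simp only [approxG, approxF, transition_congr hqp hx le_rfl, transition_congr hqp hL le_rfl,
      hinv, neg_mul_neg, mul_assoc]
  have hgk : ∀ k : ℝ, d.g.eval (-(k : ℂ)) ≠ 0 := fun k =>
    KappaData.eval_g_ne_zero hd (by simp)
  -- `R` continues `K(-z)` to the upper half-plane. `R'` continues `κ(z) K(-z)` to the lower one,
  -- with `f(z)` already cancelled against `g(-z)`.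
  let R : ℂ → Mat2 := fun z => (d.g.eval (-z))⁻¹ • P.map (Polynomial.eval (-z))
  let R' : ℂ → Mat2 := fun z =>
    (d.ε * (-1) ^ d.M * (d.g.eval z)⁻¹) • P.map (Polynomial.eval (-z))
  have hKR : ∀ k : ℝ, K (-k) = R k := fun k => hP _ (hgk k)
  have hKR' : ∀ k : ℝ, d.kappa k • R k = R' k := fun k => by
    simp only [R, R', smul_smul, KappaData.kappa, KappaData.eval_f_eq]
    congr 1
    have := hgk k
    field_simp
  have hR : ∀ i j, IsBoundedAnalyticFun upperPlane fun z => R z i j := fun i j =>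
    (KappaData.isBoundedAnalyticFun_inv_eval_g_mul hd (hPdeg i j)).neg_lower
  have hR' : ∀ i j, IsBoundedAnalyticFun lowerPlane fun z => R' z i j := fun i j => by
    -- In `R'` the numerator is evaluated at `-z` and the denominator at `z`; composing with `-X`
    -- aligns them without changing the degree.
    have h := (KappaData.isBoundedAnalyticFun_inv_eval_g_mul hd (P := (P i j).comp (-X))
      (by simpa [Polynomial.natDegree_comp] using hPdeg i j)).const_mul (d.ε * (-1) ^ d.M)
    simpa [R', mul_assoc] using h
  refine ⟨fun k => ⟨tendsto_nhds_limUnder ⟨_, hF k⟩, tendsto_nhds_limUnder ⟨_, hG k⟩⟩, Xm, Xp,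
    fun z => (Complex.exp (Complex.I * z * x) • transition p x 0 z).mulVec
      ((R z).mulVec (Zm (-z))),
    fun z => (Complex.exp (-(Complex.I * z * x)) • transition p x 0 z).mulVec
      ((R' z).mulVec (Zp (-z))),
    fun k => ?_, fun k => ?_, hXp, ?_, hXm, ?_⟩
  · rw [modX, jostF, (hF k).limUnder_eq, mul_assoc, expSigma3_mul]
    simp [expSigma3_zero]
  · rw [modY, jostG, (hG k).limUnder_eq, hKR k]
    exact mul_ofCols_mul_diag (hKR' k) _ _ _
  · exact isBoundedAnalytic_iff.2 <| isBoundedAnalytic_mulVec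
      (isBoundedAnalyticFun_upper_transition hp hB hx) <| isBoundedAnalytic_mulVec hR
      fun i => (isBoundedAnalytic_iff.1 hZm i).neg_lower
  · exact isBoundedAnalytic_iff.2 <| isBoundedAnalytic_mulVec
      (isBoundedAnalyticFun_lower_transition hp hB hx) <| isBoundedAnalytic_mulVec hR'
      fun i => (isBoundedAnalytic_iff.1 hZp i).neg_upper
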